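/- **Corollary 2.** A subgroup $H$ of a group $G$ is called *verbally closed* in $G$ if every equation $w(x_1,\dots,x_n)=h$, where $w$ is an element of the free group $F(x_1,\dots,x_n)$ and $h\in H$, has a solution in $G$ if and only if it has a solution in $H$. The subgroup $H$ is called *algebraically closed* in $G$ if every finite system of equations $w_1(x_1,\dots,x_n)=1,\ \dots,\ w_m(x_1,\dots,x_n)=1$, where each $w_i$ is an element of the free product $H*F(x_1,\dots,x_n)$, has a solution in $G$ if and only if it has a solution in $H$. A group $H$ is called *strongly verbally closed* if it is algebraically closed in every group that contains $H$ as a verbally closed subgroup. Let $H$ be a finitely generated group. The commutator subgroup $[H,H]$ is finite if and only if the centre $Z(H)$ has finite index in $H$. If $H$ is strongly verbally closed and these equivalent conditions hold, then $Z(H)$ is a direct factor of $H$, i.e. $H=Z(H)\times B$ for some subgroup $B$ of $H$. -/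

import Mathlib

universe u

/-- `H` is verbally closed in `G`: an equation `w(x₁, …, xₙ) = h`, with `w` in a free group and
`h ∈ H`, has a solution in `G` if and only if it has a solution in `H`. -/
def VerballyClosed {G : Type u} [Group G] (H : Subgroup G) : Prop :=
  ∀ (n : ℕ) (w : FreeGroup (Fin n)) (h : H),
    (∃ x : Fin n → G, FreeGroup.lift x w = (h : G)) ↔
      (∃ x : Fin n → H, FreeGroup.lift x w = h)

/-- `H` is algebraically closed in `G`: a finite system `w₁ = 1, …, wₘ = 1` in finitely many
unknowns, with all `wᵢ` in the free product of `H` and a free group, has a solution in `G` if and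
only if it has a solution in `H`. -/
def AlgebraicallyClosed {G : Type u} [Group G] (H : Subgroup G) : Prop :=
  ∀ (n m : ℕ) (w : Fin m → Monoid.Coprod H (FreeGroup (Fin n))),
    (∃ x : Fin n → G, ∀ i, Monoid.Coprod.lift H.subtype (FreeGroup.lift x) (w i) = 1) ↔
      (∃ x : Fin n → H, ∀ i, Monoid.Coprod.lift (MonoidHom.id H) (FreeGroup.lift x) (w i) = 1)

/-- `H` is strongly verbally closed: whenever `H` is embedded into a group `G` as a verbally
closed subgroup, it is algebraically closed in `G`. -/
def StronglyVerballyClosed (H : Type u) [Group H] : Prop :=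
  ∀ (G : Type u) [Group G] (f : H →* G), Function.Injective f →
    VerballyClosed f.range → AlgebraicallyClosed f.range

/-- `A` is a direct factor of `G`: `G` is the internal direct product of `A` and some `B`. -/
def IsDirectFactor {G : Type u} [Group G] (A : Subgroup G) : Prop :=
  A.Normal ∧ ∃ B : Subgroup G, B.Normal ∧ A.IsComplement' B

open Subgroup
open scoped commutatorElement IsMulCommutative

/-! The equivalence combines Schur's theorem with its converse for finitely generated groups. For
the direct factor, let `I` index the ordered pairs of distinct elements of `Fin k` and divide `H^I`
by the central subgroup of tuples `c a / c b`. For large `k`, a pigeonhole argument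
(`exists_lift_eq_of_pairwiseQuotient`) makes the diagonal copy of `H` embedded and verbally closed,
hence algebraically closed. The quotient is finitely presented, so it retracts onto `H`. This gives
`ρ : H^I → H`, the identity on the diagonal and trivial on the pairwise quotients, from which
`exists_retraction_center_of_pi` builds a retraction `H → Z(H)`; its kernel is the complement. -/

/-! ### Groups whose centre has finite index -/

theorem Subgroup.finiteIndex_map_of_surjective {G K : Type*} [Group G] [Group K]
    {f : G →* K} (hf : Function.Surjective f) (A : Subgroup G) [A.FiniteIndex] :
    (A.map f).FiniteIndex :=
  ⟨ne_zero_of_dvd_ne_zero FiniteIndex.index_ne_zero (A.index_map_dvd hf)⟩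

theorem Subgroup.map_center_le_of_surjective {G K : Type*} [Group G] [Group K]
    {f : G →* K} (hf : Function.Surjective f) : (center G).map f ≤ center K := by
  rintro _ ⟨z, hz, rfl⟩
  refine mem_center_iff.2 fun k => ?_
  obtain ⟨g, rfl⟩ := hf k
  rw [← map_mul, ← map_mul, mem_center_iff.1 hz g]

theorem finiteIndex_center_of_surjective {G K : Type*} [Group G] [Group K]
    {f : G →* K} (hf : Function.Surjective f) [(center G).FiniteIndex] :
    (center K).FiniteIndex :=
  have := finiteIndex_map_of_surjective hf (center G)
  finiteIndex_of_le (map_center_le_of_surjective hf)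

theorem finiteIndex_center_pi {ι : Type*} [Finite ι] (G : Type*) [Group G]
    [(center G).FiniteIndex] : (center (ι → G)).FiniteIndex := by
  let q : (ι → G) →* (ι → G ⧸ center G) :=
    MonoidHom.pi fun i => (QuotientGroup.mk' (center G)).comp (Pi.evalMonoidHom _ i)
  have : Finite q.range := inferInstance
  have hq : q.ker.FiniteIndex := finiteIndex_ker q
  refine finiteIndex_of_le (H := q.ker) fun x hx => mem_center_iff.2 fun g => funext fun i => ?_
  have hi : (QuotientGroup.mk (x i) : G ⧸ center G) = 1 := congrFun hx i
  exact mem_center_iff.1 ((QuotientGroup.eq_one_iff _).1 hi) (g i)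

/-- A commutator depends only on the cosets of its entries modulo the centre, so there are finitely
many; Schur's theorem does the rest. -/
theorem finite_commutator_of_finiteIndex_center (G : Type*) [Group G]
    [(center G).FiniteIndex] : Finite (commutator G) := by
  have hfin : (commutatorSet G).Finite := by
    refine (Set.finite_range fun p : (G ⧸ center G) × (G ⧸ center G) => ⁅p.1.out, p.2.out⁆).subset ?_
    rintro _ ⟨a, b, rfl⟩
    refine ⟨((a : G ⧸ center G), (b : G ⧸ center G)), ?_⟩
    obtain ⟨z, hz⟩ := QuotientGroup.mk_out_eq_mul (center G) a
    obtain ⟨y, hy⟩ := QuotientGroup.mk_out_eq_mul (center G) b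
    have hz' := mem_center_iff.1 z.2
    have hy' := mem_center_iff.1 y.2
    simp only [hz, hy, commutatorElement_def, mul_inv_rev]
    calc a * z * (b * y) * ((z : G)⁻¹ * a⁻¹) * ((y : G)⁻¹ * b⁻¹)
        = a * (z * (b * y)) * ((z : G)⁻¹ * a⁻¹) * ((y : G)⁻¹ * b⁻¹) := by group
      _ = a * b * (y * a⁻¹) * ((y : G)⁻¹ * b⁻¹) := by rw [← hz']; group
      _ = a * b * a⁻¹ * b⁻¹ := by rw [← hy']; group
  have : Finite (commutatorSet G) := hfin
  infer_instance

theorem Subgroup.fg_of_comm {A : Type*} [CommGroup A] [Group.FG A] (B : Subgroup A) : B.FG := by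
  rw [Subgroup.fg_iff_add_fg]
  have : Module.Finite ℤ (Additive A) := Module.Finite.iff_addGroup_fg.2 inferInstance
  have h := IsNoetherian.noetherian (AddSubgroup.toIntSubmodule B.toAddSubgroup)
  rw [Submodule.fg_iff_addSubgroup_fg] at h
  exact h

/-- A finitely generated group whose centre has finite index is finitely presented. -/
theorem isFinitelyPresented_of_finiteIndex_center (G : Type*) [Group G] [Group.FG G]
    [(center G).FiniteIndex] : Group.IsFinitelyPresented G := by
  obtain ⟨α, _, φ, hφ⟩ := Group.fg_iff_exists_freeGroup_hom_surjective_finite.1 ‹Group.FG G›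
  let K : Subgroup (FreeGroup α) := (center G).comap φ
  have : K.FiniteIndex := ⟨by
    rw [index_comap_of_surjective _ hφ]; exact FiniteIndex.index_ne_zero⟩
  obtain ⟨S, hSK, hS⟩ := K.fg_iff.1 ((Group.fg_iff_subgroup_fg K).1 inferInstance)
  -- These finitely many relators only make `K` central, so `G` is a quotient of `P` by a subgroup
  -- of its finitely generated centre.
  let T : Set (FreeGroup α) := Set.image2 (fun s a => ⁅s, FreeGroup.of a⁆) S Set.univ
  have hT : T.Finite := hS.image2 _ Set.finite_univ
  have hTφ : normalClosure T ≤ φ.ker := by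
    refine normalClosure_le_normal ?_
    rintro _ ⟨s, hs, a, -, rfl⟩
    have hs' : φ s ∈ center G := by
      have : s ∈ K := hSK ▸ subset_closure hs
      exact this
    change φ ⁅s, FreeGroup.of a⁆ = 1
    rw [map_commutatorElement, commutatorElement_eq_one_iff_mul_comm]
    exact (mem_center_iff.1 hs' _).symm
  let P := FreeGroup α ⧸ normalClosure T
  let q : FreeGroup α →* P := QuotientGroup.mk' _
  have hq : Function.Surjective q := QuotientGroup.mk'_surjective _
  have hKP : K ≤ (center P).comap q := by
    rw [← hSK, closure_le]
    intro s hs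
    refine mem_center_iff.2 fun g => ?_
    obtain ⟨x, rfl⟩ := hq g
    have hle : (⊤ : Subgroup (FreeGroup α)) ≤ (centralizer {q s}).comap q := by
      rw [← FreeGroup.closure_range_of, closure_le]
      rintro _ ⟨a, rfl⟩
      refine mem_centralizer_singleton_iff.2 ?_
      have h1 : q ⁅s, FreeGroup.of a⁆ = 1 :=
        (QuotientGroup.eq_one_iff _).2 (subset_normalClosure ⟨s, hs, a, trivial, rfl⟩)
      rw [map_commutatorElement, commutatorElement_eq_one_iff_mul_comm] at h1
      exact h1.symm
    exact mem_centralizer_singleton_iff.1 (hle (mem_top x))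
  have : Group.IsFinitelyPresented P := .quotient _ ⟨T, hT, rfl⟩
  have : (center P).FiniteIndex :=
    have := finiteIndex_map_of_surjective hq K
    finiteIndex_of_le (map_le_iff_le_comap.2 hKP)
  let ψ : P →* G := QuotientGroup.lift _ φ hTφ
  have hψ : ∀ x, ψ (q x) = φ x := fun x => rfl
  have hker : ψ.ker ≤ center P := by
    intro p hp
    obtain ⟨x, rfl⟩ := hq p
    refine hKP (show φ x ∈ center G from ?_)
    rw [← hψ, MonoidHom.mem_ker.1 hp]
    exact one_mem _
  refine .of_surjective ψ (fun g => ?_) ?_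
  · obtain ⟨x, rfl⟩ := hφ g
    exact ⟨q x, rfl⟩
  · have : Group.FG ψ.ker := by
      have : Group.FG (ψ.ker.subgroupOf (center P)) :=
        (Group.fg_iff_subgroup_fg _).2 (fg_of_comm (A := center P) _)
      exact Group.fg_of_surjective (f := (subgroupOfEquivOfLe hker).toMonoidHom)
        (subgroupOfEquivOfLe hker).surjective
    exact .of_FG _

/-! ### Retractions from algebraic closedness -/

/-- A finitely generated algebraically closed subgroup of a finitely presented group is a retract. -/
theorem AlgebraicallyClosed.exists_retraction {G : Type u} [Group G] [Group.IsFinitelyPresented G]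
    {H : Subgroup G} (hH : AlgebraicallyClosed H) (hfg : H.FG) :
    ∃ r : G →* H, ∀ h : H, r h = h := by
  obtain ⟨n, φ, hφ, S, hS, hker⟩ := ‹Group.IsFinitelyPresented G›.out
  obtain ⟨T, hTH, hT⟩ := H.fg_iff.1 hfg
  have := hS.to_subtype
  have := hT.to_subtype
  have hTmem : ∀ t : T, (t : G) ∈ H := fun t => hTH ▸ subset_closure t.2
  choose v hv using hφ
  obtain ⟨m, ⟨e⟩⟩ := Finite.exists_equiv_fin (S ⊕ T)
  -- The unknowns are images of the generators of `G`: the relators make them define a homomorphism,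
  -- and the equations over `T` make it fix `H`.
  let w : S ⊕ T → Monoid.Coprod H (FreeGroup (Fin n)) :=
    Sum.elim (fun s => Monoid.Coprod.inr s)
      fun t => Monoid.Coprod.inl (⟨t, hTmem t⟩ : H)⁻¹ * Monoid.Coprod.inr (v t)
  have hφlift : FreeGroup.lift (fun i => φ (FreeGroup.of i)) = φ := by ext; simp
  obtain ⟨x, hx⟩ := (hH n m fun i => w (e.symm i)).1 ⟨fun i => φ (FreeGroup.of i), fun i => by
    rw [hφlift]
    rcases e.symm i with s | t
    · have : (s : FreeGroup (Fin n)) ∈ φ.ker := hker ▸ subset_normalClosure s.2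
      simpa [w] using this
    · simp [w, hv]⟩
  have hx' : ∀ p, Monoid.Coprod.lift (MonoidHom.id H) (FreeGroup.lift x) (w p) = 1 := fun p => by
    simpa using hx (e p)
  have hle : φ.ker ≤ (FreeGroup.lift x).ker := by
    rw [← hker]
    refine normalClosure_le_normal fun s hs => ?_
    simpa [w] using hx' (Sum.inl ⟨s, hs⟩)
  let r : G →* H := φ.liftOfRightInverse v hv ⟨FreeGroup.lift x, hle⟩
  have hr : ∀ y, r (φ y) = FreeGroup.lift x y :=
    φ.liftOfRightInverse_comp_apply v hv ⟨FreeGroup.lift x, hle⟩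
  refine ⟨r, fun h => ?_⟩
  have hall : H ≤ (H.subtype.comp r).eqLocus (MonoidHom.id G) := by
    conv_lhs => rw [← hTH]
    rw [closure_le]
    intro t ht
    have h1 := hx' (Sum.inr ⟨t, ht⟩)
    simp only [w, Sum.elim_inr, map_mul, Monoid.Coprod.lift_apply_inl, Monoid.Coprod.lift_apply_inr,
      MonoidHom.id_apply, inv_mul_eq_one] at h1
    have h2 := hr (v t)
    rw [hv, ← h1] at h2
    exact congrArg Subtype.val h2
  exact Subtype.ext (hall h.2)

/-! ### Word values and the pigeonhole argument -/

theorem FreeGroup.exists_lift_eq_prod_zpow {α : Type*} [Fintype α] (w : FreeGroup α) :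
    ∃ e : α → ℤ, ∀ (A : Type u) [CommGroup A] (s : α → A),
      FreeGroup.lift s w = ∏ l, s l ^ e l := by
  classical
  induction w using FreeGroup.induction_on with
  | C1 => exact ⟨0, fun A _ s => by simp⟩
  | of a =>
    refine ⟨Pi.single a 1, fun A _ s => ?_⟩
    rw [Finset.prod_eq_single a (fun b _ hb => by simp [hb]) (by simp)]
    simp
  | inv_of a ih =>
    obtain ⟨e, he⟩ := ih
    exact ⟨-e, fun A _ s => by
      simp only [_root_.map_inv, he A s, Pi.neg_apply, zpow_neg, Finset.prod_inv_distrib]⟩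
  | mul x y hx hy =>
    obtain ⟨e, he⟩ := hx
    obtain ⟨f, hf⟩ := hy
    exact ⟨e + f, fun A _ s => by
      simp only [_root_.map_mul, he A s, hf A s, Pi.add_apply, zpow_add, Finset.prod_mul_distrib]⟩

/-- In abelian groups every word takes the same values as a power of a single variable. -/
theorem FreeGroup.exists_range_lift_eq_range_zpow {α : Type*} [Finite α] (w : FreeGroup α) :
    ∃ m : ℤ, ∀ (A : Type u) [CommGroup A],
      (Set.range fun s : α → A => FreeGroup.lift s w) = Set.range fun x : A => x ^ m := by
  have := Fintype.ofFinite α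
  obtain ⟨e, he⟩ := exists_lift_eq_prod_zpow.{u} w
  -- The gcd of the exponent sums; Bézout coefficients give the reverse inclusion.
  let m := Submodule.IsPrincipal.generator (Ideal.span (Set.range e))
  have hm : m ∈ Ideal.span (Set.range e) := Submodule.IsPrincipal.generator_mem _
  obtain ⟨v, hv⟩ := Ideal.mem_span_range_iff_exists_fun.1 hm
  have hd : ∀ l, ∃ q, e l = q * m := fun l => by
    obtain ⟨q, hq⟩ := (Submodule.IsPrincipal.mem_iff_eq_smul_generator _).1
      (Ideal.subset_span (Set.mem_range_self l) : e l ∈ Ideal.span (Set.range e))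
    exact ⟨q, hq⟩
  choose q hq using hd
  refine ⟨m, fun A _ => Set.Subset.antisymm ?_ ?_⟩
  · rintro _ ⟨s, rfl⟩
    refine ⟨∏ l, s l ^ q l, ?_⟩
    simp only [he A s, ← Finset.prod_zpow, ← zpow_mul, ← hq]
  · rintro _ ⟨z, rfl⟩
    refine ⟨fun l => z ^ v l, ?_⟩
    simp only [he, ← zpow_mul, ← hv]
    exact (map_sum (MonoidHom.toAdditiveRight (zpowersHom A z)) _ _).symm

theorem FreeGroup.lift_mul_center {α G : Type*} [Group G] (g : α → G) (s : α → center G)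
    (w : FreeGroup α) :
    FreeGroup.lift (fun i => g i * s i) w = FreeGroup.lift g w * (FreeGroup.lift s w : center G) := by
  have hs : ∀ (z : center G) (x : G), (z : G) * x = x * z := fun z x => (mem_center_iff.1 z.2 x).symm
  induction w using FreeGroup.induction_on with
  | C1 => simp
  | of a => simp
  | inv_of a ih =>
    rw [_root_.map_inv, _root_.map_inv, _root_.map_inv, ih, mul_inv_rev,
      InvMemClass.coe_inv, ← InvMemClass.coe_inv, hs]
  | mul x y hx hy =>
    rw [_root_.map_mul, _root_.map_mul, _root_.map_mul, hx, hy, Subgroup.coe_mul, mul_assoc,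
      ← mul_assoc _ _ (Subtype.val _), hs (FreeGroup.lift s x)]
    simp only [mul_assoc]

/-- Ordered pairs of distinct indices. -/
abbrev OffDiag (k : ℕ) : Type := {p : Fin k × Fin k // p.1 ≠ p.2}

/-- The homomorphism sending a tuple of central elements to the tuple of its pairwise quotients. -/
def pairwiseQuotient (H : Type u) [Group H] (k : ℕ) :
    (Fin k → center H) →* (OffDiag k → H) :=
  MonoidHom.pi fun p => (center H).subtype.comp
    (Pi.evalMonoidHom (fun _ => center H) p.1.1 / Pi.evalMonoidHom (fun _ => center H) p.1.2)

theorem pairwiseQuotient_apply {H : Type u} [Group H] {k : ℕ} (c : Fin k → center H)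
    (p : OffDiag k) : pairwiseQuotient H k c p = (c p.1.1 / c p.1.2 : center H) :=
  rfl

/-- If a word takes the values `h * (c a / c b)` for all `a ≠ b`, where `c` is a sufficiently long
tuple of central elements, then it takes the value `h`. -/
theorem exists_lift_eq_of_pairwiseQuotient {H : Type u} [Group H] [Finite (commutator H)]
    [(center H).FiniteIndex] {k : ℕ} (hk : Nat.card ((H ⧸ center H) × commutator H) + 2 ≤ k) {n : ℕ}
    (w : FreeGroup (Fin n)) (g : OffDiag k → Fin n → H) (h : H) (c : Fin k → center H)
    (hg : ∀ p, FreeGroup.lift (g p) w = h * pairwiseQuotient H k c p) :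
    ∃ t : Fin n → H, FreeGroup.lift t w = h := by
  obtain ⟨m, hm⟩ := FreeGroup.exists_range_lift_eq_range_zpow.{u} w
  have hx : ∀ p, ∃ x : H, (x ^ m)⁻¹ * FreeGroup.lift (g p) w ∈ commutator H := fun p => by
    obtain ⟨y, hy⟩ := (hm (Abelianization H)).subset
      ⟨fun i => Abelianization.of (g p i), rfl⟩
    obtain ⟨x, rfl⟩ := QuotientGroup.mk_surjective y
    refine ⟨x, QuotientGroup.eq.1 ?_⟩
    have h1 : FreeGroup.lift (fun i => Abelianization.of (g p i)) w
        = Abelianization.of (FreeGroup.lift (g p) w) := by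
      have : FreeGroup.lift (fun i => Abelianization.of (g p i))
        = Abelianization.of.comp (FreeGroup.lift (g p)) := by ext; simp
      rw [this]; rfl
    exact hy.trans h1
  choose x hx using hx
  obtain ⟨k, rfl⟩ : ∃ j, k = j + 1 := ⟨k - 1, by lia⟩
  -- Fixing the first index 0 leaves more second indices than pigeonholes. A coincidence makes two
  -- values of `w` differ by `z ^ m` with `z` central.
  let pair : Fin k → OffDiag (k + 1) := fun b => ⟨(0, b.succ), (Fin.succ_ne_zero b).symm⟩
  have := Fintype.ofFinite ((H ⧸ center H) × commutator H)
  obtain ⟨a, b, hab, heq⟩ := Fintype.exists_ne_map_eq_of_card_lt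
    (fun b => (((x (pair b) : H ⧸ center H), ⟨_, hx (pair b)⟩) : (H ⧸ center H) × commutator H))
    (by rw [Fintype.card_fin, ← Nat.card_eq_fintype_card]; lia)
  simp only [Prod.mk.injEq, Subtype.mk.injEq] at heq
  obtain ⟨z, hz⟩ : ∃ z : center H, x (pair b) = x (pair a) * z :=
    ⟨⟨_, QuotientGroup.eq.1 heq.1⟩, by simp⟩
  have hzc : ∀ y : H, Commute y (z : H) := mem_center_iff.1 z.2
  have hw : FreeGroup.lift (g (pair b)) w = FreeGroup.lift (g (pair a)) w * (z : H) ^ m := by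
    have h2 := heq.2
    rw [hz, (hzc _).mul_zpow, mul_inv_rev, mul_assoc, eq_inv_mul_iff_mul_eq,
      ← ((hzc _).zpow_right m).eq, mul_assoc, inv_mul_eq_iff_eq_mul, mul_inv_cancel_left] at h2
    exact h2.symm
  have hcab : c a.succ / c b.succ = z ^ m := by
    simp only [hg, pairwiseQuotient_apply, pair, mul_assoc, mul_right_inj] at hw
    have : c 0 / c b.succ = c 0 / c a.succ * z ^ m := Subtype.ext (by simpa using hw)
    rw [← div_eq_iff_eq_mul'] at this
    rw [← this, div_div_div_cancel_left]
  -- At the pair `(a.succ, b.succ)` the value is `h * z ^ m`; a central twist of the solution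
  -- removes `z ^ m`.
  obtain ⟨s, hs⟩ := (hm (center H)).superset ⟨z⁻¹, rfl⟩
  let q : OffDiag (k + 1) := ⟨(a.succ, b.succ), fun e => hab (Fin.succ_injective _ e)⟩
  refine ⟨fun i => g q i * s i, ?_⟩
  rw [FreeGroup.lift_mul_center, show FreeGroup.lift s w = z⁻¹ ^ m from hs, hg,
    pairwiseQuotient_apply, show c q.1.1 / c q.1.2 = z ^ m from hcab, mul_assoc, ← Subgroup.coe_mul]
  simp

/-! ### From a retraction of a direct power to a retraction onto the centre -/

section Retraction

variable {ι H : Type*} [Group H] [DecidableEq ι]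

/-- With `u = ρ (mulSingle j h)`, conjugating `mulSingle i y` by the diagonal `u` does not change
its image, as `u` commutes with that image. So `ρ (mulSingle i u)` commutes with the image of
`mulSingle i y`, and with that of the remaining coordinates of `y`. -/
theorem apply_mulSingle_apply_mulSingle_mem_center {ρ : (ι → H) →* H}
    (hρ : ∀ h, ρ (Function.const ι h) = h) {i j : ι} (hij : i ≠ j) (h : H) :
    ρ (Pi.mulSingle i (ρ (Pi.mulSingle j h))) ∈ center H := by
  set u := ρ (Pi.mulSingle j h) with hu
  refine mem_center_iff.2 fun y => ?_
  have hsplit : Function.const ι y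
      = Pi.mulSingle i y * Function.update (Function.const ι y) i 1 := by
    ext l
    by_cases hl : l = i
    · subst hl; simp
    · simp [hl]
  have hrest : Commute (Pi.mulSingle i u) (Function.update (Function.const ι y) i 1) := by
    ext l
    by_cases hl : l = i
    · subst hl; simp
    · simp [hl]
  have huy : Commute u (ρ (Pi.mulSingle i y)) :=
    ((Pi.mulSingle_commute (f := fun _ : ι => H) hij.symm h y)).map ρ
  have hconj : Pi.mulSingle i (u * y * u⁻¹)
      = Function.const ι u * Pi.mulSingle i y * (Function.const ι u)⁻¹ := by
    ext l
    by_cases hl : l = i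
    · subst hl; simp
    · simp [hl]
  have hfix : ρ (Pi.mulSingle i (u * y * u⁻¹)) = ρ (Pi.mulSingle i y) := by
    rw [hconj, map_mul, map_mul, map_inv, hρ, huy.eq, mul_inv_cancel_right]
  have hsame : Commute (ρ (Pi.mulSingle i u)) (ρ (Pi.mulSingle i y)) := by
    rw [Pi.mulSingle_mul, Pi.mulSingle_mul, Pi.mulSingle_inv, map_mul, map_mul, map_inv,
      mul_inv_eq_iff_eq_mul] at hfix
    exact hfix
  have hall : Commute (ρ (Pi.mulSingle i u)) (ρ (Function.const ι y)) := by
    rw [hsplit, map_mul]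
    exact hsame.mul_right (hrest.map ρ)
  rw [hρ] at hall
  exact hall.eq.symm

/-- Additively, the restrictions `σ i` of `ρ` to central coordinates satisfy `∑ σ j = 1` and `∑ ε i
j σ j = 0`, so `∑ (1 - ε i j) σ i σ j = ∑ σ i = 1`. The diagonal terms vanish, and for `i ≠ j` the
product `σ i σ j` extends to a homomorphism from all of `H`. -/
theorem exists_retraction_center_of_pi [Fintype ι] {ρ : (ι → H) →* H}
    (hρ : ∀ h, ρ (Function.const ι h) = h) (ε : ι → ι → ℤ) (hε : ∀ i, ε i i = 1)
    (hker : ∀ i (z : center H), ρ (fun j => (z : H) ^ ε i j) = 1) :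
    ∃ φ : H →* center H, ∀ z : center H, φ z = z := by
  let incl : (ι → center H) →* (ι → H) :=
    MonoidHom.pi fun i => (center H).subtype.comp (Pi.evalMonoidHom _ i)
  have hcen : ∀ f, ρ.comp incl f ∈ center H := fun f =>
    map_center_le_of_surjective (fun h => ⟨_, hρ h⟩)
      ⟨incl f, mem_center_iff.2 fun g => funext fun i => mem_center_iff.1 (f i).2 (g i), rfl⟩
  let ρZ : (ι → center H) →* center H := (ρ.comp incl).codRestrict _ hcen
  let σ : ι → center H →* center H := fun i => ρZ.comp (MonoidHom.mulSingle (fun _ => center H) i)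
  have hσ : ∀ i z, (σ i z : H) = ρ (Pi.mulSingle i (z : H)) := fun i z => by
    change ρ (incl (Pi.mulSingle i z)) = _
    congr 1
    ext l
    by_cases hl : l = i
    · subst hl; simp [incl]
    · simp [incl, hl]
  have hprod : ∀ f, ρZ f = ∏ i, σ i (f i) := fun f => by
    conv_lhs => rw [← Finset.univ_prod_mulSingle f, map_prod]
    rfl
  have hone : ∀ z, ∏ i, σ i z = z := fun z => by
    rw [← hprod fun _ => z]
    exact Subtype.ext (hρ z)
  have hrel : ∀ i z, ∏ j, σ j z ^ ε i j = 1 := fun i z => by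
    simp only [← map_zpow]
    rw [← hprod fun j => z ^ ε i j]
    exact Subtype.ext (hker i z)
  -- The value for `i = j` is immaterial: its exponent `1 - ε i i` is 0.
  let θ : ι → ι → H →* center H := fun i j =>
    if hij : i ≠ j then
      (ρ.comp ((MonoidHom.mulSingle (fun _ => H) i).comp
        (ρ.comp (MonoidHom.mulSingle (fun _ => H) j)))).codRestrict _
        (apply_mulSingle_apply_mulSingle_mem_center hρ hij)
    else 1
  have hθ : ∀ i j, i ≠ j → ∀ z : center H, θ i j z = σ i (σ j z) := fun i j hij z => by
    apply Subtype.ext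
    rw [hσ, hσ]
    simp only [θ, dif_pos hij]
    rfl
  refine ⟨∏ i, ∏ j, θ i j ^ (1 - ε i j), fun z => ?_⟩
  have hrow : ∀ i, ∏ j, θ i j z ^ (1 - ε i j) = σ i z := fun i => by
    have h1 : ∀ j, θ i j z ^ (1 - ε i j) = σ i (σ j z / σ j z ^ ε i j) := fun j => by
      rcases eq_or_ne i j with rfl | hij
      · simp [hε]
      · rw [hθ i j hij, map_div, map_zpow, zpow_sub, zpow_one, div_eq_mul_inv]
    rw [Finset.prod_congr rfl fun j _ => h1 j, ← map_prod, Finset.prod_div_distrib, hone, hrel,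
      div_one]
  calc (∏ i, ∏ j, θ i j ^ (1 - ε i j)) (z : H)
      = ∏ i, ∏ j, θ i j z ^ (1 - ε i j) := by simp [MonoidHom.finsetProd_apply]
    _ = z := by rw [Finset.prod_congr rfl fun i _ => hrow i, hone]

end Retraction

theorem isDirectFactor_of_retraction {G : Type u} [Group G] {A : Subgroup G} [hA : A.Normal]
    (φ : G →* A) (hφ : ∀ a : A, φ a = a) : IsDirectFactor A := by
  refine ⟨hA, φ.ker, inferInstance, isComplement'_of_disjoint_and_mul_eq_univ ?_ ?_⟩
  · rw [disjoint_def]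
    intro x hx hk
    rw [← show ((φ x : A) : G) = x from congrArg Subtype.val (hφ ⟨x, hx⟩), MonoidHom.mem_ker.1 hk]
    rfl
  · refine Set.eq_univ_of_forall fun g => ⟨φ g, (φ g).2, (φ g : G)⁻¹ * g, ?_, by simp⟩
    simp [MonoidHom.mem_ker, hφ]

/-! ### The diagonal as a verbally closed subgroup -/

section

variable {H : Type u} [Group H] {k : ℕ}

instance pairwiseQuotient_range_normal : (pairwiseQuotient H k).range.Normal where
  conj_mem := by
    rintro _ ⟨c, rfl⟩ g
    have : Commute g (pairwiseQuotient H k c) :=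
      funext fun p => mem_center_iff.1 (c p.1.1 / c p.1.2 : center H).2 (g p)
    rw [this.eq, mul_inv_cancel_right]
    exact ⟨c, rfl⟩

/-- The diagonal embedding of `H` into the quotient of its direct power by the subgroup of
pairwise quotients of central tuples. -/
def diagonalHom (H : Type u) [Group H] (k : ℕ) :
    H →* (OffDiag k → H) ⧸ (pairwiseQuotient H k).range :=
  (QuotientGroup.mk' _).comp (Pi.constMonoidHom (OffDiag k) H)

theorem exists_lift_eq_of_diagonalHom [Finite (commutator H)] [(center H).FiniteIndex]
    (hk : Nat.card ((H ⧸ center H) × commutator H) + 2 ≤ k) {n : ℕ} (w : FreeGroup (Fin n)) (h : H)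
    (x : Fin n → (OffDiag k → H) ⧸ (pairwiseQuotient H k).range)
    (hx : FreeGroup.lift x w = diagonalHom H k h) : ∃ t : Fin n → H, FreeGroup.lift t w = h := by
  choose g hg using fun i => QuotientGroup.mk'_surjective _ (x i)
  have hlift : FreeGroup.lift x
      = (QuotientGroup.mk' (pairwiseQuotient H k).range).comp (FreeGroup.lift g) := by
    ext i; simp [← hg]
  rw [hlift] at hx
  obtain ⟨c, hc⟩ := QuotientGroup.eq.1 hx.symm
  refine exists_lift_eq_of_pairwiseQuotient hk w (fun p i => g i p) h c fun p => ?_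
  have heval : FreeGroup.lift (fun i => g i p)
      = (Pi.evalMonoidHom (fun _ => H) p).comp (FreeGroup.lift g) := by
    ext i; simp
  rw [heval, hc]
  simp

/-- This is the case of the empty word in no unknowns. -/
theorem diagonalHom_injective [Finite (commutator H)] [(center H).FiniteIndex]
    (hk : Nat.card ((H ⧸ center H) × commutator H) + 2 ≤ k) :
    Function.Injective (diagonalHom H k) := by
  refine (injective_iff_map_eq_one _).2 fun h hh => ?_
  obtain ⟨t, ht⟩ := exists_lift_eq_of_diagonalHom hk (n := 0) 1 h (fun i => i.elim0) (by simp [hh])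
  simpa using ht.symm

theorem verballyClosed_range_diagonalHom [Finite (commutator H)] [(center H).FiniteIndex]
    (hk : Nat.card ((H ⧸ center H) × commutator H) + 2 ≤ k) :
    VerballyClosed (diagonalHom H k).range := by
  rintro n w ⟨_, h, rfl⟩
  constructor
  · rintro ⟨x, hx⟩
    obtain ⟨t, ht⟩ := exists_lift_eq_of_diagonalHom hk w h x hx
    refine ⟨fun i => (diagonalHom H k).rangeRestrict (t i), ?_⟩
    have : FreeGroup.lift (fun i => (diagonalHom H k).rangeRestrict (t i))
        = (diagonalHom H k).rangeRestrict.comp (FreeGroup.lift t) := by ext; simp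
    rw [this, MonoidHom.comp_apply, ht]
    rfl
  · rintro ⟨x, hx⟩
    refine ⟨fun i => (diagonalHom H k).range.subtype (x i), ?_⟩
    have : FreeGroup.lift (fun i => (diagonalHom H k).range.subtype (x i))
        = (diagonalHom H k).range.subtype.comp (FreeGroup.lift x) := by ext; simp
    rw [this, MonoidHom.comp_apply, hx]
    rfl

end

/-! ### Splitting off the centre -/

theorem StronglyVerballyClosed.exists_retraction_center {H : Type u} [Group H] [Group.FG H]
    [Finite (commutator H)] [(center H).FiniteIndex] (hH : StronglyVerballyClosed H) :
    ∃ φ : H →* center H, ∀ z : center H, φ z = z := by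
  obtain ⟨k, hk⟩ : ∃ k, Nat.card ((H ⧸ center H) × commutator H) + 2 ≤ k := ⟨_, le_rfl⟩
  have hinj := diagonalHom_injective hk
  have hclosed := hH _ (diagonalHom H k) hinj (verballyClosed_range_diagonalHom hk)
  have := finiteIndex_center_pi (ι := OffDiag k) H
  have := finiteIndex_center_of_surjective (QuotientGroup.mk'_surjective (pairwiseQuotient H k).range)
  have := isFinitelyPresented_of_finiteIndex_center
    ((OffDiag k → H) ⧸ (pairwiseQuotient H k).range)
  obtain ⟨r, hr⟩ := hclosed.exists_retraction ((Group.fg_iff_subgroup_fg _).1 inferInstance)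
  let e := MonoidHom.ofInjective hinj
  let ρ : (OffDiag k → H) →* H := (e.symm.toMonoidHom.comp r).comp (QuotientGroup.mk' _)
  -- Row `p` of the exponents comes from the pairwise quotients of the tuple with `z` at `p.1.1` and
  -- 1 elsewhere; its entry at `p` is 1 since the indices differ.
  refine exists_retraction_center_of_pi (ρ := ρ) (fun h => ?_)
    (fun p q => (if q.1.1 = p.1.1 then 1 else 0) - (if q.1.2 = p.1.1 then 1 else 0))
    (fun p => by simp [p.2.symm]) fun p z => ?_
  · exact e.symm_apply_eq.2 (hr (e h))
  · have hmem : (fun q : OffDiag k => (z : H) ^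
        ((if q.1.1 = p.1.1 then 1 else 0) - (if q.1.2 = p.1.1 then 1 else 0) : ℤ))
        = pairwiseQuotient H k (Pi.mulSingle p.1.1 z) := by
      ext q
      rw [pairwiseQuotient_apply, zpow_sub, div_eq_mul_inv]
      by_cases h1 : q.1.1 = p.1.1 <;> by_cases h2 : q.1.2 = p.1.1 <;>
        simp [h1, h2]
    rw [hmem]
    have h1 : QuotientGroup.mk' (pairwiseQuotient H k).range
        (pairwiseQuotient H k (Pi.mulSingle p.1.1 z)) = 1 :=
      (QuotientGroup.eq_one_iff _).2 ⟨_, rfl⟩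
    simp only [ρ, MonoidHom.comp_apply, h1, map_one]

theorem corollary2 (H : Type u) [Group H] [Group.FG H] :
    (Finite (commutator H) ↔ (Subgroup.center H).FiniteIndex) ∧
      (StronglyVerballyClosed H → Finite (commutator H) →
        IsDirectFactor (Subgroup.center H)) := by
  have hcenter : Finite (commutator H) → (center H).FiniteIndex := fun _ => by
    have : Finite (commutatorSet H) :=
      Set.Finite.subset (Set.toFinite (commutator H : Set H))
        (commutator_eq_closure H ▸ subset_closure)
    exact finiteIndex_center
  refine ⟨⟨hcenter, fun _ => finite_commutator_of_finiteIndex_center H⟩, fun hH hfin => ?_⟩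
  have := hcenter hfin
  obtain ⟨φ, hφ⟩ := hH.exists_retraction_center
  exact isDirectFactor_of_retraction φ hφ
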